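/- Let $\Omega\subseteq\mathbb C$ be open, let $F\subseteq\mathbb N_0=\{0,1,2,\dots\}$ be non-empty, and let $$H_F^\infty(\Omega)=\{f:\Omega\to\mathbb C \text{ holomorphic} : f^{(l)} \text{ is bounded on } \Omega \text{ for all } l\in F\}.$$ Let $(\Omega_i)_{i\in I}$ be the connected components of $\Omega$, fix any point $z_i\in\Omega_i$ for each $i\in I$, and endow $H_F^\infty(\Omega)$ with the vector space topology induced by the seminorms $$\sup_{z\in\Omega}|f^{(l)}(z)|\ \ (l\in F)\qquad\text{and}\qquad |f^{(l)}(z_i)|\ \ (0\le l<\min F,\ i\in I).$$ A holomorphic function $f:\Omega\to\mathbb C$ is called extendable if there exist two open discs $D_1,D_2\subseteq\mathbb C$ (of positive, finite radii) with $D_2\cap\Omega\ne\varnothing$, $D_2\cap(\mathbb C\setminus\Omega)\neq\varnothing$ and $\overline{D_1}\subseteq D_2\cap\Omega$, and a holomorphic function $G:D_2\to\mathbb C$ with $G|_{D_1}=f|_{D_1}$; otherwise $f$ is called non-extendable. Then the set of non-extendable functions in $H_F^\infty(\Omega)$ is either empty or a dense $G_\delta$ subset of $H_F^\infty(\Omega)$.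 -/

import Mathlib

open TopologicalSpace

namespace HolSpace

noncomputable section

/-- Extension by zero of a function on the open set `Ω`; only its values and derivatives at
points of `Ω` are ever used. -/
def extZero {Ω : Opens ℂ} (f : Ω → ℂ) : ℂ → ℂ := Function.extend Subtype.val f 0

/-- `f : Ω → ℂ` is holomorphic on the open set `Ω`. -/
def IsHolomorphic {Ω : Opens ℂ} (f : Ω → ℂ) : Prop :=
  DifferentiableOn ℂ (extZero f) (Ω : Set ℂ)

/-- The `l`-th complex derivative `f^(l) : Ω → ℂ` of `f : Ω → ℂ`. -/
def derivOn {Ω : Opens ℂ} (l : ℕ) (f : Ω → ℂ) : Ω → ℂ :=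
  fun z => iteratedDeriv l (extZero f) (z : ℂ)

theorem extZero_apply {Ω : Opens ℂ} (f : Ω → ℂ) (z : Ω) : extZero f (z : ℂ) = f z :=
  Subtype.val_injective.extend_apply f 0 z

theorem extZero_zero {Ω : Opens ℂ} : extZero (0 : Ω → ℂ) = 0 := by
  funext w
  by_cases hw : ∃ a : Ω, (a : ℂ) = w
  · obtain ⟨a, rfl⟩ := hw
    simp [extZero_apply]
  · simp [extZero, Function.extend_apply' _ _ _ hw]

theorem extZero_add {Ω : Opens ℂ} (f g : Ω → ℂ) :
    extZero (f + g) = extZero f + extZero g := by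
  funext w
  by_cases hw : ∃ a : Ω, (a : ℂ) = w
  · obtain ⟨a, rfl⟩ := hw
    simp [extZero_apply]
  · simp [extZero, Function.extend_apply' _ _ _ hw]

theorem extZero_smul {Ω : Opens ℂ} (c : ℂ) (f : Ω → ℂ) :
    extZero (c • f) = c • extZero f := by
  funext w
  by_cases hw : ∃ a : Ω, (a : ℂ) = w
  · obtain ⟨a, rfl⟩ := hw
    simp [extZero_apply]
  · simp [extZero, Function.extend_apply' _ _ _ hw]

theorem IsHolomorphic.contDiffAt {Ω : Opens ℂ} {f : Ω → ℂ} (hf : IsHolomorphic f)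
    (n : WithTop ℕ∞) (z : Ω) : ContDiffAt ℂ n (extZero f) (z : ℂ) :=
  (DifferentiableOn.analyticAt hf (Ω.isOpen.mem_nhds z.2)).contDiffAt

theorem derivOn_add {Ω : Opens ℂ} (l : ℕ) {f g : Ω → ℂ} (hf : IsHolomorphic f)
    (hg : IsHolomorphic g) : derivOn l (f + g) = derivOn l f + derivOn l g := by
  funext z
  simp only [derivOn, extZero_add, Pi.add_apply]
  exact iteratedDeriv_add (hf.contDiffAt l z) (hg.contDiffAt l z)

theorem derivOn_smul {Ω : Opens ℂ} (l : ℕ) (c : ℂ) (f : Ω → ℂ) :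
    derivOn l (c • f) = c • derivOn l f := by
  funext z
  simp only [derivOn, extZero_smul, Pi.smul_apply]
  rw [iteratedDeriv_const_smul_field]

theorem derivOn_zero {Ω : Opens ℂ} (l : ℕ) : derivOn l (0 : Ω → ℂ) = 0 := by
  simpa using derivOn_smul l (0 : ℂ) (0 : Ω → ℂ)

/-- The space `H_F^∞(Ω)` of all holomorphic `f : Ω → ℂ` such that `f^(l)` is bounded on `Ω` for
every `l ∈ F`, as a vector space. -/
def HInf (Ω : Opens ℂ) (F : Set ℕ) : Submodule ℂ (Ω → ℂ) where
  carrier := {f | IsHolomorphic f ∧ ∀ l ∈ F, ∃ M : ℝ, ∀ z : Ω, ‖derivOn l f z‖ ≤ M}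
  add_mem' := by
    rintro f g ⟨hf, hf'⟩ ⟨hg, hg'⟩
    refine ⟨?_, fun l hl => ?_⟩
    · rw [IsHolomorphic, extZero_add]
      exact DifferentiableOn.add hf hg
    · obtain ⟨M, hM⟩ := hf' l hl
      obtain ⟨N, hN⟩ := hg' l hl
      refine ⟨M + N, fun z => ?_⟩
      rw [derivOn_add l hf hg]
      exact norm_add_le_of_le (hM z) (hN z)
  zero_mem' := by
    refine ⟨?_, fun l _ => ⟨0, fun z => ?_⟩⟩
    · rw [IsHolomorphic, extZero_zero]
      exact differentiableOn_const 0
    · simp [derivOn_zero]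
  smul_mem' := by
    rintro c f ⟨hf, hf'⟩
    refine ⟨?_, fun l hl => ?_⟩
    · rw [IsHolomorphic, extZero_smul]
      exact DifferentiableOn.const_smul hf c
    · obtain ⟨M, hM⟩ := hf' l hl
      refine ⟨‖c‖ * M, fun z => ?_⟩
      rw [derivOn_smul, Pi.smul_apply, norm_smul]
      exact mul_le_mul_of_nonneg_left (hM z) (norm_nonneg c)

theorem HInf.bddAbove {Ω : Opens ℂ} {F : Set ℕ} {l : ℕ} (hl : l ∈ F) (f : HInf Ω F) :
    BddAbove (Set.range fun z : Ω => ‖derivOn l (f : Ω → ℂ) z‖) := by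
  obtain ⟨M, hM⟩ := f.2.2 l hl
  exact ⟨M, by rintro _ ⟨z, rfl⟩; exact hM z⟩

/-- The seminorm `f ↦ sup_{z ∈ Ω} |f^(l)(z)|` on `H_F^∞(Ω)`, for `l ∈ F`. -/
def supSeminorm (Ω : Opens ℂ) (F : Set ℕ) (l : ℕ) (hl : l ∈ F) : Seminorm ℂ (HInf Ω F) :=
  Seminorm.of (fun f => ⨆ z : Ω, ‖derivOn l (f : Ω → ℂ) z‖)
    (by
      intro f g
      have h0 : 0 ≤ (⨆ z : Ω, ‖derivOn l (f : Ω → ℂ) z‖) + ⨆ z : Ω, ‖derivOn l (g : Ω → ℂ) z‖ :=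
        add_nonneg (Real.iSup_nonneg fun _ => norm_nonneg _)
          (Real.iSup_nonneg fun _ => norm_nonneg _)
      refine Real.iSup_le (fun z => ?_) h0
      rw [Submodule.coe_add, derivOn_add l f.2.1 g.2.1]
      exact norm_add_le_of_le (le_ciSup (HInf.bddAbove hl f) z)
        (le_ciSup (HInf.bddAbove hl g) z))
    (by
      intro c f
      rw [Submodule.coe_smul, derivOn_smul, Real.mul_iSup_of_nonneg (norm_nonneg c)]
      simp only [Pi.smul_apply, norm_smul])

/-- The seminorm `f ↦ |f^(l)(a)|` on `H_F^∞(Ω)`, for a point `a ∈ Ω`. -/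
def pointSeminorm (Ω : Opens ℂ) (F : Set ℕ) (l : ℕ) (a : Ω) : Seminorm ℂ (HInf Ω F) :=
  Seminorm.of (fun f => ‖derivOn l (f : Ω → ℂ) a‖)
    (by
      intro f g
      rw [Submodule.coe_add, derivOn_add l f.2.1 g.2.1]
      exact norm_add_le _ _)
    (by
      intro c f
      rw [Submodule.coe_smul, derivOn_smul, Pi.smul_apply, norm_smul])

/-- The seminorms defining the natural topology of `H_F^∞(Ω)`: `sup_Ω |f^(l)|` for `l ∈ F`, and
`|f^(l)(a i)|` for `0 ≤ l < min F` and `i` a connected component of `Ω`, where `a i` is the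
point chosen in the component `i`. -/
def seminorms (Ω : Opens ℂ) (F : Set ℕ) (a : ConnectedComponents Ω → Ω) :
    SeminormFamily ℂ (HInf Ω F) ({l : ℕ // l ∈ F} ⊕ ({l : ℕ // l < sInf F} × ConnectedComponents Ω))
  | Sum.inl l => supSeminorm Ω F l.1 l.2
  | Sum.inr p => pointSeminorm Ω F p.1.1 (a p.2)

/-- The natural topology of `H_F^∞(Ω)`: the one induced by the family `seminorms Ω F a`. -/
@[reducible] def naturalTopology (Ω : Opens ℂ) (F : Set ℕ) (a : ConnectedComponents Ω → Ω) :
    TopologicalSpace (HInf Ω F) :=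
  (seminorms Ω F a).moduleFilterBasis.topology

/-- `f` is extendable (in the sense of Riemann surfaces): for some open discs `D₁ = D(c₁, r₁)`
and `D₂ = D(c₂, r₂)` such that `D₂` meets both `Ω` and its complement and
`closure D₁ ⊆ D₂ ∩ Ω`, some holomorphic function on `D₂` agrees with `f` on `D₁`. -/
def IsExtendable {Ω : Opens ℂ} (f : Ω → ℂ) : Prop :=
  ∃ (c₁ c₂ : ℂ) (r₁ r₂ : ℝ), 0 < r₁ ∧ 0 < r₂ ∧
    (Metric.ball c₂ r₂ ∩ (Ω : Set ℂ)).Nonempty ∧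
    (Metric.ball c₂ r₂ ∩ (Ω : Set ℂ)ᶜ).Nonempty ∧
    closure (Metric.ball c₁ r₁) ⊆ Metric.ball c₂ r₂ ∩ (Ω : Set ℂ) ∧
    ∃ g : ℂ → ℂ, DifferentiableOn ℂ g (Metric.ball c₂ r₂) ∧
      ∀ z : Ω, (z : ℂ) ∈ Metric.ball c₁ r₁ → g z = f z

/-- The set of the non-extendable functions in `H_F^∞(Ω)`. -/
def nonExtendable (Ω : Opens ℂ) (F : Set ℕ) : Set (HInf Ω F) :=
  {f | ¬ IsExtendable (f : Ω → ℂ)}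

end

end HolSpace

namespace HolSpace

open Metric Filter Topology

/-! ### Extendability and growth of Taylor coefficients -/

section Taylor

variable {Ω : Opens ℂ} {f : Ω → ℂ}

/-! A function is extendable exactly when, at some centre `c` in a fixed countable dense subset of
`Ω` and for some rational `r` whose disc around `c` leaves `Ω`, the quantities `|f^(k)(c)| r^k / k!`
are bounded by some `n` (`isExtendable_iff_exists_taylorBounded`). For fixed `c`, `r`, `n` this
condition is closed, because evaluations of derivatives are continuous (`continuous_pointSeminorm`),
so the extendable functions form a countable union of closed sets.

Density needs no Baire category argument. For fixed `c`, `r`, the union over `n` is a linear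
subspace of extendable functions. A non-extendable `f` lies outside each of these subspaces, so a
line `g + t f` meets each at most once, and arbitrarily small `t` avoid all of them. -/

theorem IsHolomorphic.differentiableOn_iteratedDeriv (hf : IsHolomorphic f) (k : ℕ) :
    DifferentiableOn ℂ (iteratedDeriv k (extZero f)) (Ω : Set ℂ) := by
  induction k with
  | zero => rwa [iteratedDeriv_zero]
  | succ k ih =>
    rw [iteratedDeriv_succ]
    exact ih.deriv Ω.isOpen

theorem iteratedDeriv_iteratedDeriv (m j : ℕ) (g : ℂ → ℂ) :
    iteratedDeriv j (iteratedDeriv m g) = iteratedDeriv (m + j) g := by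
  rw [iteratedDeriv_eq_iterate, iteratedDeriv_eq_iterate, iteratedDeriv_eq_iterate, add_comm m j,
    Function.iterate_add_apply]

/-- A holomorphic function whose Taylor coefficients at `c` grow at most like those of a power
series converging on a disc around `c` that leaves `Ω` is extendable. -/
theorem isExtendable_of_taylor_bound (hf : IsHolomorphic f) (c : Ω) {r M : ℝ} (hr : 0 < r)
    (hmeet : (ball (c : ℂ) r ∩ (Ω : Set ℂ)ᶜ).Nonempty)
    (hM : ∀ k : ℕ, ‖derivOn k f c‖ * r ^ k ≤ M * k.factorial) : IsExtendable f := by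
  have han : AnalyticAt ℂ (extZero f) (c : ℂ) := hf.analyticAt (Ω.isOpen.mem_nhds c.2)
  have hp := han.hasFPowerSeriesAt
  set p := FormalMultilinearSeries.ofScalars ℂ
    (fun n => iteratedDeriv n (extZero f) (c : ℂ) / (n.factorial : ℂ)) with hpdef
  have hrad : ENNReal.ofReal r ≤ p.radius := by
    refine p.le_radius_of_bound (r := r.toNNReal) M fun n => ?_
    have h := hM n
    have hn : (0 : ℝ) < n.factorial := by exact_mod_cast n.factorial_pos
    rw [hpdef, Real.coe_toNNReal r hr.le, FormalMultilinearSeries.ofScalars_norm, norm_div, Complex.norm_natCast,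
      div_mul_eq_mul_div, div_le_iff₀ hn]
    exact h
  have hpos : 0 < p.radius := lt_of_lt_of_le (ENNReal.ofReal_pos.2 hr) hrad
  have hsum := p.hasFPowerSeriesOnBall hpos
  obtain ⟨ρ, hρ⟩ := hp
  have heq : ∀ᶠ z in 𝓝 (c : ℂ), p.sum (z - c) = extZero f z := by
    filter_upwards [Metric.eball_mem_nhds (c : ℂ) hρ.r_pos] with z hz
    have h1 := hρ.sum (y := z - c) (by
      simpa [Metric.mem_eball, edist_eq_enorm_sub] using hz)
    rw [← h1]; simp
  have hnear : ∀ᶠ z in 𝓝 (c : ℂ), p.sum (z - c) = extZero f z ∧ z ∈ ball (c : ℂ) r ∩ (Ω : Set ℂ) :=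
    heq.and (inter_mem (ball_mem_nhds _ hr) (Ω.isOpen.mem_nhds c.2))
  obtain ⟨δ, hδ, hball⟩ := Metric.eventually_nhds_iff_ball.1 hnear
  -- The sum of the Taylor series is the continuation. Halving `δ` keeps the closure of the small
  -- disc inside the region where the sum agrees with `f`.
  refine ⟨c, c, δ / 2, r, half_pos hδ, hr, ⟨c, mem_ball_self hr, c.2⟩, hmeet, fun z hz => ?_,
    fun z => p.sum (z - c), ?_, fun z hz => ?_⟩
  · exact (hball z (closedBall_subset_ball (half_lt_self hδ) (closure_ball_subset_closedBall hz))).2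
  · have hd : DifferentiableOn ℂ p.sum (Metric.eball 0 p.radius) :=
      hsum.analyticOnNhd.differentiableOn
    refine hd.comp (by fun_prop) fun z hz => ?_
    refine Metric.eball_subset_eball hrad ?_
    rw [Metric.eball_ofReal]
    simpa [dist_eq_norm] using hz
  · rw [← extZero_apply f z]
    exact (hball z (ball_subset_ball (half_le_self hδ.le) hz)).1

/-- If `f` is extendable then, at some point of any given dense subset of `Ω`, its Taylor series
converges on a disc of rational radius that leaves `Ω`. -/
theorem IsExtendable.exists_taylor_bound (hf : IsHolomorphic f) (h : IsExtendable f) {D : Set Ω}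
    (hD : Dense D) : ∃ c ∈ D, ∃ r : ℚ, 0 < r ∧ (ball (c : ℂ) r ∩ (Ω : Set ℂ)ᶜ).Nonempty ∧
      ∃ n : ℕ, ∀ k : ℕ, ‖derivOn k f c‖ * (r : ℝ) ^ k ≤ n * k.factorial := by
  obtain ⟨c₁, c₂, r₁, r₂, hr₁, hr₂, -, hmeet, hsub, g, hg, hgf⟩ := h
  have hsub' : ball c₁ r₁ ⊆ ball c₂ r₂ ∩ (Ω : Set ℂ) := subset_closure.trans hsub
  -- Agreement of germs, not just membership in `Ω`, is needed: `D₂ ∩ Ω` may be disconnected, and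
  -- `g` need not continue `f` on its other components.
  let V : Set ℂ := {z | z ∈ ball c₂ r₂ ∧ z ∈ Ω ∧ extZero f =ᶠ[𝓝 z] g}
  have hVopen : IsOpen V := by
    have : V = ball c₂ r₂ ∩ ((Ω : Set ℂ) ∩ {z | extZero f =ᶠ[𝓝 z] g}) := rfl
    rw [this]
    exact isOpen_ball.inter (Ω.isOpen.inter isOpen_setOfPred_eventually_nhds)
  have hc₁ : c₁ ∈ V := by
    have hm := mem_ball_self (x := c₁) hr₁
    refine ⟨(hsub' hm).1, (hsub' hm).2, ?_⟩
    filter_upwards [isOpen_ball.mem_nhds hm] with z hz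
    rw [hgf ⟨z, (hsub' hz).2⟩ hz]
    exact extZero_apply f ⟨z, (hsub' hz).2⟩
  -- Otherwise `V` is relatively closed in `D₂` by isolation of zeros, hence all of `D₂` by
  -- connectedness, although `D₂` leaves `Ω`.
  obtain ⟨p, hpV, hpb, hpΩ⟩ : ∃ p, p ∈ closure V ∧ p ∈ ball c₂ r₂ ∧ p ∉ Ω := by
    by_contra! hcon
    have hss : ball c₂ r₂ ⊆ V := by
      refine (convex_ball c₂ r₂).isPreconnected.subset_of_closure_inter_subset hVopen
        ⟨c₁, hc₁.1, hc₁⟩ ?_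
      rintro p ⟨hpV, hpb⟩
      have hpΩ := hcon p hpV hpb
      refine ⟨hpb, hpΩ, ?_⟩
      by_contra hne
      have hfa : AnalyticAt ℂ (extZero f) p := hf.analyticAt (Ω.isOpen.mem_nhds hpΩ)
      have hga : AnalyticAt ℂ g p := hg.analyticAt (isOpen_ball.mem_nhds hpb)
      have hev := (hfa.eventually_eq_or_eventually_ne hga).resolve_left hne
      have hpn : p ∉ V := fun hp => hne hp.2.2
      obtain ⟨z, hz, hzV⟩ := mem_closure_iff_nhds.1 hpV _ (eventually_nhdsWithin_iff.1 hev)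
      have hzp : z ∈ ({p} : Set ℂ)ᶜ := by
        rintro rfl
        exact hpn hzV
      exact hz hzp hzV.2.2.self_of_nhds
    obtain ⟨q, hqb, hq⟩ := hmeet
    exact hq (hss hqb).2.1
  obtain ⟨ε, hε, hεb⟩ := Metric.isOpen_iff.1 isOpen_ball p hpb
  have hne : ((Subtype.val : Ω → ℂ) ⁻¹' (V ∩ ball p (ε / 4))).Nonempty := by
    obtain ⟨z, hzV, hz⟩ := Metric.mem_closure_iff.1 hpV (ε / 4) (by positivity)
    exact ⟨⟨z, hzV.2.1⟩, hzV, by rwa [mem_ball, dist_comm]⟩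
  obtain ⟨c, hc, hcD⟩ := hD.inter_open_nonempty _
    ((hVopen.inter isOpen_ball).preimage continuous_subtype_val) hne
  obtain ⟨hcV, hcp⟩ : (c : ℂ) ∈ V ∧ (c : ℂ) ∈ ball p (ε / 4) := hc
  -- As `c` is within `ε / 4` of `p`, taking `r > ε / 4` puts `p ∉ Ω` in the disc, while `r < ε / 2`
  -- keeps the closed disc inside `D₂`, where Cauchy's estimates apply to `g`.
  obtain ⟨r, hr1, hr2⟩ := exists_rat_btwn (show ε / 4 < ε / 2 by linarith)
  have hr0 : (0 : ℝ) < r := lt_trans (by positivity) hr1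
  have hcb : closedBall (c : ℂ) r ⊆ ball c₂ r₂ := by
    refine Set.Subset.trans (fun z hz => ?_) hεb
    rw [mem_ball] at hcp ⊢
    rw [mem_closedBall] at hz
    linarith [dist_triangle z (c : ℂ) p]
  obtain ⟨C, hC⟩ := (isCompact_closedBall (c : ℂ) (r : ℝ)).exists_bound_of_continuousOn
    (hg.continuousOn.mono hcb)
  obtain ⟨n, hn⟩ := exists_nat_ge C
  refine ⟨c, hcD, r, by exact_mod_cast hr0, ⟨p, ?_, hpΩ⟩, n, fun k => ?_⟩
  · rw [mem_ball] at hcp ⊢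
    rw [dist_comm]
    linarith
  · have hdc : DiffContOnCl ℂ g (ball (c : ℂ) r) :=
      (hg.mono hcb).diffContOnCl_ball subset_rfl
    have hb := Complex.norm_iteratedDeriv_le_of_forall_mem_sphere_norm_le k hr0 hdc
      fun z hz => hC z (sphere_subset_closedBall hz)
    rw [derivOn, hcV.2.2.iteratedDeriv_eq k]
    rw [le_div_iff₀ (by positivity)] at hb
    refine hb.trans ?_
    rw [mul_comm]
    gcongr

end Taylor

/-! ### Continuity of the evaluations of derivatives -/

section Continuity

variable {Ω : Opens ℂ} {F : Set ℕ}

theorem pointSeminorm_apply (l : ℕ) (z : Ω) (f : HInf Ω F) :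
    pointSeminorm Ω F l z f = ‖derivOn l (f : Ω → ℂ) z‖ := rfl

theorem norm_derivOn_le_supSeminorm {l : ℕ} (hl : l ∈ F) (f : HInf Ω F) (z : Ω) :
    ‖derivOn l (f : Ω → ℂ) z‖ ≤ supSeminorm Ω F l hl f :=
  le_ciSup (HInf.bddAbove hl f) z

/-- Cauchy's estimate for `f^(m)` on a closed disc around `z` inside `Ω`. -/
theorem continuous_pointSeminorm_of_mem [TopologicalSpace (HInf Ω F)]
    [IsTopologicalAddGroup (HInf Ω F)] {m : ℕ} (hm : m ∈ F)
    (hsup : Continuous (supSeminorm Ω F m hm)) {k : ℕ} (hk : m ≤ k) (z : Ω) :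
    Continuous (pointSeminorm Ω F k z) := by
  obtain ⟨j, rfl⟩ := Nat.exists_eq_add_of_le hk
  obtain ⟨ρ, hρ, hb⟩ := Metric.nhds_basis_closedBall.mem_iff.1 (Ω.isOpen.mem_nhds z.2)
  let C : NNReal := NNReal.mk (j.factorial / ρ ^ j) (by positivity)
  refine Seminorm.continuous_of_le (q := C • supSeminorm Ω F m hm) (hsup.const_smul C) fun f => ?_
  have hd := f.2.1.differentiableOn_iteratedDeriv m
  have h := Complex.norm_iteratedDeriv_le_of_forall_mem_sphere_norm_le j hρ
    ((hd.mono hb).diffContOnCl_ball subset_rfl)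
    fun w hw => norm_derivOn_le_supSeminorm hm f ⟨w, hb (sphere_subset_closedBall hw)⟩
  rw [iteratedDeriv_iteratedDeriv] at h
  rw [pointSeminorm_apply, derivOn]
  refine h.trans (le_of_eq ?_)
  change _ = j.factorial / ρ ^ j * supSeminorm Ω F m hm f
  ring

/-- Descending from order `m`, the mean value inequality bounds `f^(k)` by its value at `z` plus the
diameter `2 * ρ` times the bound for `f^(k+1)`. -/
theorem exists_continuous_seminorm_bound_on_ball [TopologicalSpace (HInf Ω F)]
    [IsTopologicalAddGroup (HInf Ω F)] {m : ℕ} (hm : m ∈ F)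
    (hsup : Continuous (supSeminorm Ω F m hm)) {x : ℂ} {ρ : ℝ} (hb : ball x ρ ⊆ (Ω : Set ℂ))
    {z : Ω} (hz : (z : ℂ) ∈ ball x ρ) (hcont : ∀ k < m, Continuous (pointSeminorm Ω F k z))
    (j k : ℕ) (hjk : k + j = m) :
    ∃ q : Seminorm ℂ (HInf Ω F), Continuous q ∧
      ∀ (f : HInf Ω F) (w : Ω), (w : ℂ) ∈ ball x ρ → ‖derivOn k (f : Ω → ℂ) w‖ ≤ q f := by
  induction j generalizing k with
  | zero =>
    obtain rfl : k = m := hjk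
    exact ⟨_, hsup, fun f w _ => norm_derivOn_le_supSeminorm hm f w⟩
  | succ j ih =>
    obtain ⟨q, hq, hbound⟩ := ih (k + 1) (by omega)
    have hρ : 0 < ρ := pos_of_mem_ball hz
    let C : NNReal := NNReal.mk (2 * ρ) (by positivity)
    refine ⟨pointSeminorm Ω F k z + C • q, (hcont k (by omega)).add (hq.const_smul C),
      fun f w hw => ?_⟩
    have hd := f.2.1.differentiableOn_iteratedDeriv k
    have hmv := (convex_ball x ρ).norm_image_sub_le_of_norm_deriv_le
      (f := iteratedDeriv k (extZero (f : Ω → ℂ))) (C := q f)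
      (fun y hy => hd.differentiableAt (Ω.isOpen.mem_nhds (hb hy)))
      (fun y hy => by
        rw [← iteratedDeriv_succ]
        exact hbound f ⟨y, hb hy⟩ hy) hz hw
    have hdist : ‖(w : ℂ) - z‖ ≤ 2 * ρ := by
      rw [← dist_eq_norm]
      rw [mem_ball] at hz hw
      linarith [dist_triangle_right (w : ℂ) (z : ℂ) x]
    have h2 : q f * ‖(w : ℂ) - z‖ ≤ 2 * ρ * q f := by
      rw [mul_comm]
      exact mul_le_mul_of_nonneg_right hdist (apply_nonneg q f)
    have h3 : ‖derivOn k (f : Ω → ℂ) w‖ - ‖derivOn k (f : Ω → ℂ) z‖ ≤ 2 * ρ * q f :=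
      (norm_sub_norm_le _ _).trans (hmv.trans h2)
    change _ ≤ ‖derivOn k (f : Ω → ℂ) z‖ + 2 * ρ * q f
    linarith

/-- In the natural topology, all evaluations of derivatives are continuous. -/
theorem continuous_pointSeminorm (hF : F.Nonempty) (a : ConnectedComponents Ω → Ω)
    (ha : ∀ i, ConnectedComponents.mk (a i) = i) [TopologicalSpace (HInf Ω F)]
    (hs : WithSeminorms (seminorms Ω F a)) (k : ℕ) (z : Ω) :
    Continuous (pointSeminorm Ω F k z) := by
  have := hs.topologicalAddGroup
  have hm : sInf F ∈ F := Nat.sInf_mem hF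
  have hsup : Continuous (supSeminorm Ω F (sInf F) hm) :=
    hs.continuous_seminorm (Sum.inl ⟨sInf F, hm⟩)
  rcases le_or_gt (sInf F) k with hk | hk
  · exact continuous_pointSeminorm_of_mem hm hsup hk z
  -- All orders below `min F` are treated together, since the descent uses every intermediate order.
  -- A disc inside `Ω` lies in `S` as soon as it meets `S`, so `S` is clopen; it contains the chosen
  -- points, hence every component.
  let S : Set Ω := {z | ∀ k < sInf F, Continuous (pointSeminorm Ω F k z)}
  have key : ∀ x : Ω, ∃ U ∈ 𝓝 x, ∀ y ∈ U, ∀ w ∈ U, y ∈ S → w ∈ S := by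
    intro x
    obtain ⟨ρ, hρ, hb⟩ := Metric.nhds_basis_ball.mem_iff.1 (Ω.isOpen.mem_nhds x.2)
    refine ⟨Subtype.val ⁻¹' ball (x : ℂ) ρ,
      continuous_subtype_val.continuousAt.preimage_mem_nhds (ball_mem_nhds _ hρ),
      fun y hy w hw hyS l hl => ?_⟩
    obtain ⟨q, hq, hbound⟩ := exists_continuous_seminorm_bound_on_ball hm hsup hb hy hyS
      (sInf F - l) l (by omega)
    exact Seminorm.continuous_of_le hq fun f => hbound f w hw
  have hclopen : IsClopen S := by
    constructor
    · refine ⟨isOpen_iff_mem_nhds.2 fun x hx => ?_⟩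
      obtain ⟨U, hU, h⟩ := key x
      filter_upwards [hU] with y hy hyS
      exact hx (h y hy x (mem_of_mem_nhds hU) hyS)
    · refine isOpen_iff_mem_nhds.2 fun x hx => ?_
      obtain ⟨U, hU, h⟩ := key x
      filter_upwards [hU] with y hy
      exact h x (mem_of_mem_nhds hU) y hy hx
  have haS : a (ConnectedComponents.mk z) ∈ S := fun l hl =>
    hs.continuous_seminorm (Sum.inr (⟨l, hl⟩, ConnectedComponents.mk z))
  have hz : z ∈ connectedComponent (a (ConnectedComponents.mk z)) :=
    ConnectedComponents.coe_eq_coe'.1 (ha _).symm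
  exact hclopen.connectedComponent_subset haS hz k hk

end Continuity

/-! ### The `G_δ` property and density -/

section TaylorBounded

variable {Ω : Opens ℂ} {F : Set ℕ}

/-- The functions in `H_F^∞(Ω)` whose Taylor coefficients at `c` are at most `M / r ^ k`. -/
def taylorBounded (F : Set ℕ) (c : Ω) (r M : ℝ) : Set (HInf Ω F) :=
  {f | ∀ k : ℕ, pointSeminorm Ω F k c f * r ^ k ≤ M * k.factorial}

theorem isClosed_taylorBounded [TopologicalSpace (HInf Ω F)] {c : Ω}
    (hc : ∀ k, Continuous (pointSeminorm Ω F k c)) (r M : ℝ) :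
    IsClosed (taylorBounded F c r M) := by
  rw [taylorBounded, Set.ofPred_forall]
  exact isClosed_iInter fun k => isClosed_le ((hc k).mul continuous_const) continuous_const

/-- Together with `taylorBounded_smul`, this gives the linear structure of the union over all
bounds. -/
theorem taylorBounded_sub {c : Ω} {r M N : ℝ} (hr : 0 ≤ r) {f g : HInf Ω F}
    (hf : f ∈ taylorBounded F c r M) (hg : g ∈ taylorBounded F c r N) :
    f - g ∈ taylorBounded F c r (M + N) := fun k => by
  have h := mul_le_mul_of_nonneg_right (map_sub_le_add (pointSeminorm Ω F k c) f g)
    (pow_nonneg hr k)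
  linarith [hf k, hg k]

theorem taylorBounded_smul {c : Ω} {r M : ℝ} {f : HInf Ω F} (s : ℂ)
    (hf : f ∈ taylorBounded F c r M) : s • f ∈ taylorBounded F c r (‖s‖ * M) := fun k => by
  rw [map_smul_eq_mul, mul_assoc, mul_assoc]
  exact mul_le_mul_of_nonneg_left (hf k) (norm_nonneg s)

/-- The centres, taken in `D`, and rational radii of discs that leave `Ω`. -/
abbrev ExitDisc (D : Set Ω) : Type :=
  {d : D × ℚ // 0 < d.2 ∧ (ball ((d.1 : Ω) : ℂ) d.2 ∩ (Ω : Set ℂ)ᶜ).Nonempty}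

theorem isExtendable_iff_exists_taylorBounded {D : Set Ω} (hD : Dense D) (f : HInf Ω F) :
    IsExtendable (f : Ω → ℂ) ↔
      ∃ (d : ExitDisc D) (n : ℕ), f ∈ taylorBounded F (d.1.1 : Ω) d.1.2 n := by
  constructor
  · intro h
    obtain ⟨c, hc, r, hr, hmeet, n, hn⟩ := h.exists_taylor_bound f.2.1 hD
    exact ⟨⟨(⟨c, hc⟩, r), hr, hmeet⟩, n, hn⟩
  · rintro ⟨d, n, hn⟩
    exact isExtendable_of_taylor_bound f.2.1 d.1.1 (by exact_mod_cast d.2.1) d.2.2 hn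

theorem isGδ_nonExtendable [TopologicalSpace (HInf Ω F)]
    (hc : ∀ (k : ℕ) (z : Ω), Continuous (pointSeminorm Ω F k z)) :
    IsGδ (nonExtendable Ω F) := by
  obtain ⟨D, hDc, hD⟩ := TopologicalSpace.exists_countable_dense Ω
  have := hDc.to_subtype
  have heq : nonExtendable Ω F =
      ⋂ (d : ExitDisc D) (n : ℕ), (taylorBounded F (d.1.1 : Ω) d.1.2 n)ᶜ := by
    ext f
    simp only [nonExtendable, Set.mem_ofPred_eq, isExtendable_iff_exists_taylorBounded hD,
      Set.mem_iInter, Set.mem_compl_iff, not_exists]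
  rw [heq]
  exact IsGδ.iInter fun d => IsGδ.iInter fun n =>
    (isClosed_taylorBounded (fun k => hc k _) _ _).isOpen_compl.isGδ

/-- On a complex line in the direction of a non-extendable function, only countably many
functions are extendable. -/
theorem countable_setOf_isExtendable_add_smul {f : HInf Ω F} (hf : f ∈ nonExtendable Ω F)
    (g : HInf Ω F) : {t : ℂ | IsExtendable ((g + t • f : HInf Ω F) : Ω → ℂ)}.Countable := by
  obtain ⟨D, hDc, hD⟩ := TopologicalSpace.exists_countable_dense Ω
  have := hDc.to_subtype
  have hss : {t : ℂ | IsExtendable ((g + t • f : HInf Ω F) : Ω → ℂ)} ⊆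
      ⋃ d : ExitDisc D, {t : ℂ | ∃ n : ℕ, g + t • f ∈ taylorBounded F (d.1.1 : Ω) d.1.2 n} :=
    fun t ht => Set.mem_iUnion.2 ((isExtendable_iff_exists_taylorBounded hD _).1 ht)
  -- Two parameters `t ≠ s` for the same disc, even with different bounds, would give a Taylor bound
  -- for `f` itself, the difference quotient of the two functions.
  refine (Set.countable_iUnion fun d => Set.Subsingleton.countable ?_).mono hss
  rintro t ⟨n, hn⟩ s ⟨m, hm⟩
  by_contra hts
  have hr : (0 : ℝ) < d.1.2 := by exact_mod_cast d.2.1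
  have h := taylorBounded_smul (t - s)⁻¹ (taylorBounded_sub hr.le hn hm)
  have heq : (t - s)⁻¹ • (g + t • f - (g + s • f)) = f := by
    rw [add_sub_add_left_eq_sub, ← sub_smul t s f, inv_smul_smul₀ (sub_ne_zero.2 hts)]
  rw [heq] at h
  exact hf (isExtendable_of_taylor_bound f.2.1 d.1.1 hr d.2.2 h)

theorem dense_nonExtendable [TopologicalSpace (HInf Ω F)] [ContinuousAdd (HInf Ω F)]
    [ContinuousSMul ℂ (HInf Ω F)] (hne : (nonExtendable Ω F).Nonempty) :
    Dense (nonExtendable Ω F) := by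
  obtain ⟨f, hf⟩ := hne
  intro g
  -- A countable subset of `ℂ` has dense complement, so `0` is a limit of good parameters, and `g +
  -- t f` tends to `g` along them.
  have h0 := (countable_setOf_isExtendable_add_smul hf g).dense_compl ℂ 0
  have hcont : Continuous fun t : ℂ => g + t • f := by fun_prop
  have h := map_mem_closure (t := nonExtendable Ω F) hcont h0 fun t ht => ht
  simpa using h

end TaylorBounded

end HolSpace

theorem theorem6p2 (Ω : TopologicalSpace.Opens ℂ) (F : Set ℕ) (hF : F.Nonempty)
    (a : ConnectedComponents Ω → Ω)
    (ha : ∀ i : ConnectedComponents Ω, ConnectedComponents.mk (a i) = i) :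
    HolSpace.nonExtendable Ω F = ∅ ∨
      (@Dense (HolSpace.HInf Ω F) (HolSpace.naturalTopology Ω F a)
          (HolSpace.nonExtendable Ω F) ∧
        @IsGδ (HolSpace.HInf Ω F) (HolSpace.naturalTopology Ω F a)
          (HolSpace.nonExtendable Ω F)) := by
  rcases Set.eq_empty_or_nonempty (HolSpace.nonExtendable Ω F) with h | h
  · exact Or.inl h
  let _ := HolSpace.naturalTopology Ω F a
  have hs : WithSeminorms (HolSpace.seminorms Ω F a) := ⟨rfl⟩
  have := hs.topologicalAddGroup
  have := hs.continuousSMul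
  exact Or.inr ⟨HolSpace.dense_nonExtendable h,
    HolSpace.isGδ_nonExtendable (HolSpace.continuous_pointSeminorm hF a ha hs)⟩
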